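/- For a permutation $\pi \in S_n$ let $t(\pi)$ denote the length of the shortest string of transpositions whose product is $\pi$. For an irreducible complex representation $\lambda$ of $S_n$ with character $\chi_\lambda$ and dimension $d_\lambda$, say that $\lambda$ is \emph{big} if $d_\lambda > e^{-\sqrt{n}\log n}\sqrt{n!}$, where $\log$ is the natural logarithm. Then for every real $A > \sqrt{2}\,e^2$ there is an integer $N$ such that for all $n \ge N$, all big irreducible representations $\lambda$ of $S_n$, and all $\pi \in S_n$ with $t(\pi) > \sqrt{n}\log n$, \[ \left|\frac{\chi_\lambda(\pi)}{d_\lambda}\right| \le A^{t(\pi)}\, n^{-t(\pi)/2}. \] -/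

import Mathlib

/-- `transpositionLength π` is the length of the shortest string of transpositions
whose product is `π`. -/
noncomputable def transpositionLength {n : ℕ} (π : Equiv.Perm (Fin n)) : ℕ :=
  sInf {k : ℕ | ∃ l : List (Equiv.Perm (Fin n)),
    l.length = k ∧ (∀ τ ∈ l, τ.IsSwap) ∧ l.prod = π}

/-- The minimum in `transpositionLength` is attained. -/
theorem transpositionLength_spec {n : ℕ} (π : Equiv.Perm (Fin n)) :
    ∃ l : List (Equiv.Perm (Fin n)),
      l.length = transpositionLength π ∧ (∀ τ ∈ l, τ.IsSwap) ∧ l.prod = π := by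
  have h : {k : ℕ | ∃ l : List (Equiv.Perm (Fin n)),
      l.length = k ∧ (∀ τ ∈ l, τ.IsSwap) ∧ l.prod = π}.Nonempty :=
    ⟨_, (Equiv.Perm.swapFactors π).1, rfl, (Equiv.Perm.swapFactors π).2.2,
      (Equiv.Perm.swapFactors π).2.1⟩
  exact Nat.sInf_mem h

/-- A complex representation `V` of `S_n` is big if its dimension is more than
`e ^ (-√n log n) √(n!)`. -/
def IsBig {n : ℕ} {V : Type*} [AddCommGroup V] [Module ℂ V]
    (_ρ : Representation ℂ (Equiv.Perm (Fin n)) V) : Prop :=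
  Real.exp (-(√(n : ℝ) * Real.log n)) * √(n.factorial : ℝ) < (Module.finrank ℂ V : ℝ)

section

open Equiv Equiv.Perm

/-! Write `t` for the transposition length, `d` for the dimension and `K` for the size of the class
of `π`. Since `∑ |χ|² = n!` and `χ` is constant on classes, `K |χ(π)|² ≤ n!`. Bigness together with
`t > √n log n` gives `n! ≤ d² e^{2t}`, and counting the class gives `K ≥ (n/e²)^t`. Hence `|χ(π)/d|²
≤ e^{4t} n^{-t}`, which is the bound with `e²` in place of `A`. -/

/-- On an endomorphism of finite order, the trace of the inverse is the conjugate of the trace. -/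
theorem LinearMap.trace_inverse_eq_star_trace {V : Type*} [AddCommGroup V] [Module ℂ V]
    [FiniteDimensional ℂ V] {f g : Module.End ℂ V} {m : ℕ} (hm : m ≠ 0) (hf : f ^ m = 1)
    (hgf : g * f = 1) :
    LinearMap.trace ℂ V g = star (LinearMap.trace ℂ V f) := by
  classical
  -- `f` is killed by the separable `X ^ m - 1`, so it is diagonalisable with roots of unity as
  -- eigenvalues, whose inverses are their conjugates.
  have hss : f.IsSemisimple := by
    apply Module.End.isSemisimple_of_squarefree_aeval_eq_zero
      (p := (Polynomial.X ^ m - Polynomial.C 1 : Polynomial ℂ))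
    · exact (Polynomial.separable_X_pow_sub_C (1 : ℂ) (by exact_mod_cast hm)
        one_ne_zero).squarefree
    · simp [hf]
  have htop : ⨆ μ, f.eigenspace μ = ⊤ := by
    rw [← Module.End.iSup_maxGenEigenspace_eq_top f]
    congr 1
    ext1 μ
    exact (hss.isFinitelySemisimple.maxGenEigenspace_eq_eigenspace μ).symm
  have hint : DirectSum.IsInternal f.eigenspace :=
    DirectSum.isInternal_submodule_of_iSupIndep_of_iSup_eq_top f.eigenspaces_iSupIndep htop
  have hne : ∀ {μ : ℂ} {x : V}, x ∈ f.eigenspace μ → x ≠ 0 → μ ^ m = 1 := by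
    intro μ x hx hx0
    have h1 : (f ^ m) x = μ ^ m • x := by
      have := (Module.End.HasEigenvector.pow_apply (f := f) (μ := μ) (v := x) ⟨hx, hx0⟩ m)
      simpa using this
    rw [hf, Module.End.one_apply] at h1
    by_contra hμ
    have h2 : (μ ^ m - 1) • x = 0 := by rw [sub_smul, one_smul, ← h1, sub_self]
    rcases smul_eq_zero.mp h2 with h | h
    · exact hμ (sub_eq_zero.mp h)
    · exact hx0 h
  have hgx : ∀ {μ : ℂ} {x : V}, x ∈ f.eigenspace μ → g x = star μ • x := by
    intro μ x hx
    by_cases hx0 : x = 0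
    · simp [hx0]
    have hμ := hne hx hx0
    have hnorm : ‖μ‖ = 1 := Complex.norm_eq_one_of_pow_eq_one hμ hm
    have hstar : star μ * μ = 1 := by
      have := Complex.conj_mul' μ
      simpa [hnorm] using this
    have h1 : g (f x) = x := by
      rw [← Module.End.mul_apply, hgf, Module.End.one_apply]
    rw [Module.End.mem_eigenspace_iff.mp hx, map_smul] at h1
    calc g x = (star μ * μ) • g x := by rw [hstar, one_smul]
      _ = star μ • x := by rw [mul_smul, h1]
  have hfm : ∀ μ, Set.MapsTo f (f.eigenspace μ) (f.eigenspace μ) := fun μ x hx => by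
    rw [SetLike.mem_coe, Module.End.mem_eigenspace_iff.mp hx]
    exact Submodule.smul_mem _ _ hx
  have hgm : ∀ μ, Set.MapsTo g (f.eigenspace μ) (f.eigenspace μ) := fun μ x hx => by
    rw [SetLike.mem_coe, hgx hx]
    exact Submodule.smul_mem _ _ hx
  have hfin := WellFoundedGT.finite_ne_bot_of_iSupIndep f.eigenspaces_iSupIndep
  rw [LinearMap.trace_eq_sum_trace_restrict' hint hfin hfm,
    LinearMap.trace_eq_sum_trace_restrict' hint hfin hgm, star_sum]
  refine Finset.sum_congr rfl fun μ _ => ?_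
  have hf' : f.restrict (hfm μ) = μ • LinearMap.id := by
    ext x
    exact Module.End.mem_eigenspace_iff.mp x.2
  have hg' : g.restrict (hgm μ) = star μ • LinearMap.id := by
    ext x
    exact hgx x.2
  rw [hf', hg', map_smul, map_smul, LinearMap.trace_id]
  simp

theorem Representation.char_inv_eq_star {G V : Type*} [Group G] [Finite G] [AddCommGroup V]
    [Module ℂ V] [FiniteDimensional ℂ V] (ρ : Representation ℂ G V) (g : G) :
    ρ.character g⁻¹ = star (ρ.character g) := by
  apply LinearMap.trace_inverse_eq_star_trace (m := Nat.card G) Nat.card_pos.ne'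
  · rw [← map_pow, pow_card_eq_one', map_one]
  · rw [← map_mul, inv_mul_cancel, map_one]

theorem Representation.IsIrreducible.sum_sq_norm_character {G V : Type*} [Group G] [Fintype G]
    [AddCommGroup V] [Module ℂ V] [FiniteDimensional ℂ V] {ρ : Representation ℂ G V}
    (hρ : ρ.IsIrreducible) : ∑ g : G, ‖ρ.character g‖ ^ 2 = Nat.card G := by
  have hc : (Nat.card G : ℂ) ≠ 0 := by exact_mod_cast Nat.card_pos.ne'
  have : Invertible (Nat.card G : ℂ) := invertibleOfNonzero hc
  have h := Representation.char_orthonormal ρ ρ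
  rw [if_pos ⟨Representation.Equiv.refl ρ⟩, inv_mul_eq_iff_eq_mul₀ hc] at h
  have h2 : ((∑ g : G, ‖ρ.character g‖ ^ 2 : ℝ) : ℂ) = (Nat.card G : ℝ) := by
    push_cast
    rw [← mul_one (Nat.card G : ℂ)]
    rw [← h]
    refine Finset.sum_congr rfl fun g _ => ?_
    rw [ρ.char_inv_eq_star]
    exact (Complex.mul_conj' _).symm
  exact_mod_cast h2

theorem Representation.IsIrreducible.card_isConj_mul_sq_norm_character_le {G V : Type*} [Group G]
    [Fintype G] [AddCommGroup V] [Module ℂ V] [FiniteDimensional ℂ V] {ρ : Representation ℂ G V}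
    (hρ : ρ.IsIrreducible) (g : G) :
    (Nat.card {h : G | IsConj g h} : ℝ) * ‖ρ.character g‖ ^ 2 ≤ Nat.card G := by
  classical
  rw [← hρ.sum_sq_norm_character]
  calc (Nat.card {h : G | IsConj g h} : ℝ) * ‖ρ.character g‖ ^ 2
      = ∑ h with IsConj g h, ‖ρ.character h‖ ^ 2 := by
        rw [Finset.sum_congr rfl (g := fun _ => ‖ρ.character g‖ ^ 2), Finset.sum_const,
          nsmul_eq_mul]
        · congr 2
          simp [Fintype.card_subtype]
        · intro h hh
          obtain ⟨c, hc⟩ := isConj_iff.mp (Finset.mem_filter.mp hh).2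
          rw [← hc, ρ.char_conj]
    _ ≤ _ := Finset.sum_le_sum_of_subset_of_nonneg (Finset.subset_univ _) fun _ _ _ => by positivity

/-- Factor by factor, `n (s - i) ≤ (n - i) s`, because `i s ≤ i n`. -/
theorem Nat.pow_mul_factorial_le_descFactorial_mul_pow {n s : ℕ} (h : s ≤ n) :
    n ^ s * s.factorial ≤ n.descFactorial s * s ^ s := by
  have hs : s.factorial = ∏ i ∈ Finset.range s, (s - i) := by
    rw [← Nat.descFactorial_self, Nat.descFactorial_eq_prod_range]
  calc n ^ s * s.factorial = ∏ i ∈ Finset.range s, n * (s - i) := by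
        rw [hs, Finset.prod_mul_distrib, Finset.prod_const, Finset.card_range]
    _ ≤ ∏ i ∈ Finset.range s, (n - i) * s := by
        refine Finset.prod_le_prod' fun i _ => ?_
        rw [Nat.mul_sub, Nat.sub_mul, mul_comm n i]
        exact Nat.sub_le_sub_left (Nat.mul_le_mul_left i h) _
    _ = n.descFactorial s * s ^ s := by
        rw [Nat.descFactorial_eq_prod_range, Finset.prod_mul_distrib, Finset.prod_const,
          Finset.card_range]

theorem Nat.pow_le_descFactorial_mul_exp {n s : ℕ} (h : s ≤ n) :
    (n : ℝ) ^ s ≤ n.descFactorial s * Real.exp s := by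
  have h1 : (n : ℝ) ^ s * s.factorial ≤ n.descFactorial s * (s : ℝ) ^ s := by
    exact_mod_cast Nat.pow_mul_factorial_le_descFactorial_mul_pow h
  have h2 := Real.pow_div_factorial_le_exp (s : ℝ) (Nat.cast_nonneg s) s
  have hs : (0 : ℝ) < s.factorial := by exact_mod_cast s.factorial_pos
  calc (n : ℝ) ^ s ≤ n.descFactorial s * (s : ℝ) ^ s / s.factorial := by
        rwa [le_div_iff₀ hs]
    _ = n.descFactorial s * ((s : ℝ) ^ s / s.factorial) := by ring
    _ ≤ _ := by gcongr

/-- A part `i` of multiplicity `m` contributes `i^m m! ≤ (i m)^m ≤ n^m`. For a cycle type, the left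
side is the part of the centralizer order coming from nontrivial cycles. -/
theorem Multiset.prod_mul_prod_factorial_count_le {m : Multiset ℕ} {n : ℕ} (h : m.sum ≤ n) :
    m.prod * ∏ i ∈ m.toFinset, (m.count i).factorial ≤ n ^ m.card := by
  rw [Finset.prod_multiset_count, ← Finset.prod_mul_distrib, ← Multiset.toFinset_sum_count_eq,
    ← Finset.prod_pow_eq_pow_sum]
  refine Finset.prod_le_prod' fun i hi => ?_
  have hin : i * m.count i ≤ n := by
    refine le_trans ?_ h
    rw [Finset.sum_multiset_count, mul_comm]
    exact Finset.single_le_sum (f := fun i => m.count i • i) (fun _ _ => Nat.zero_le _) hi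
  calc i ^ m.count i * (m.count i).factorial ≤ i ^ m.count i * m.count i ^ m.count i := by
        gcongr
        exact Nat.factorial_le_pow _
    _ = (i * m.count i) ^ m.count i := (mul_pow _ _ _).symm
    _ ≤ _ := by gcongr

theorem Equiv.Perm.two_mul_card_cycleType_le_sum {α : Type*} [Fintype α] [DecidableEq α]
    (σ : Perm α) : 2 * σ.cycleType.card ≤ σ.cycleType.sum := by
  have := Multiset.card_nsmul_le_sum (s := σ.cycleType) (a := 2)
    fun _ hx => two_le_of_mem_cycleType hx
  simpa [mul_comm] using this

/-- A conjugacy class of permutations of `n` points whose members have `s` moved points and `c`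
nontrivial cycles has at least `(n / e²) ^ (s - c)` members. -/
theorem Equiv.Perm.pow_le_card_isConj_mul_exp {n : ℕ} (hn : 0 < n) (σ : Perm (Fin n)) :
    (n : ℝ) ^ (σ.cycleType.sum - σ.cycleType.card) ≤
      Nat.card {τ : Perm (Fin n) | IsConj σ τ} *
        Real.exp 2 ^ (σ.cycleType.sum - σ.cycleType.card) := by
  have hs : σ.cycleType.sum ≤ n := by simpa using σ.sum_cycleType_le
  have h2 := σ.two_mul_card_cycleType_le_sum
  have hcard := card_isConj_mul_eq σ
  rw [Fintype.card_fin] at hcard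
  have hpq := Multiset.prod_mul_prod_factorial_count_le hs
  have hdesc := Nat.pow_le_descFactorial_mul_exp hs
  have hfac := Nat.factorial_mul_descFactorial hs
  generalize Nat.card {τ : Perm (Fin n) | IsConj σ τ} = K at *
  generalize (∏ i ∈ σ.cycleType.toFinset, (σ.cycleType.count i).factorial) = Q at *
  generalize σ.cycleType.prod = P at *
  generalize σ.cycleType.sum = s at *
  generalize σ.cycleType.card = c at *
  have hdes : n.descFactorial s = K * (P * Q) := by
    apply Nat.eq_of_mul_eq_mul_left (n - s).factorial_pos
    rw [hfac, ← hcard]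
    ring
  have hle : (n.descFactorial s : ℝ) ≤ K * (n : ℝ) ^ c := by
    rw [hdes]
    exact_mod_cast Nat.mul_le_mul_left K hpq
  have hn' : (0 : ℝ) < (n : ℝ) ^ c := by positivity
  refine le_of_mul_le_mul_right ?_ hn'
  calc (n : ℝ) ^ (s - c) * (n : ℝ) ^ c = (n : ℝ) ^ s := by
        rw [← pow_add, Nat.sub_add_cancel (by omega)]
    _ ≤ n.descFactorial s * Real.exp s := hdesc
    _ ≤ K * (n : ℝ) ^ c * Real.exp 2 ^ (s - c) := by
        gcongr
        rw [← Real.exp_nat_mul, Real.exp_le_exp]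
        -- Nontrivial cycles have length at least 2, so `2c ≤ s`; this turns `e^s` into a power of
        -- `e²`.
        exact_mod_cast (by omega : s ≤ (s - c) * 2)
    _ = _ := by ring

theorem List.exists_isSwap_prod_eq_formPerm {α : Type*} [DecidableEq α] :
    ∀ l : List α, l.Nodup → ∃ w : List (Equiv.Perm α),
      w.length = l.length - 1 ∧ (∀ τ ∈ w, τ.IsSwap) ∧ w.prod = l.formPerm
  | [], _ => ⟨[], by simp⟩
  | [_], _ => ⟨[], by simp⟩
  | x :: y :: l, h => by
    obtain ⟨w, hw, hs, hp⟩ := List.exists_isSwap_prod_eq_formPerm (y :: l) h.of_cons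
    refine ⟨Equiv.swap x y :: w, by simp [hw], ?_, by simp [hp]⟩
    intro τ hτ
    rcases List.mem_cons.mp hτ with rfl | hτ
    · exact ⟨x, y, fun hxy => by simp [hxy] at h, rfl⟩
    · exact hs τ hτ

/-- A permutation with `s` moved points and `c` nontrivial cycles is a product of `s - c`
transpositions. -/
theorem Equiv.Perm.exists_isSwap_prod_eq {α : Type*} [Fintype α] [DecidableEq α] (σ : Perm α) :
    ∃ w : List (Perm α), w.length = σ.cycleType.sum - σ.cycleType.card ∧
      (∀ τ ∈ w, τ.IsSwap) ∧ w.prod = σ := by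
  induction σ using cycle_induction_on with
  | base_one => exact ⟨[], by simp⟩
  | base_cycles σ hσ =>
    obtain ⟨x, hx, -⟩ := id hσ
    obtain ⟨w, hw, hs, hp⟩ := List.exists_isSwap_prod_eq_formPerm _ (nodup_toList σ x)
    refine ⟨w, ?_, hs, ?_⟩
    · rw [hw, length_toList, hσ.cycleType, hσ.cycleOf_eq hx]
      simp
    · rw [hp, formPerm_toList, hσ.cycleOf_eq hx]
  | induction_disjoint σ τ hd _ hσ hτ =>
    obtain ⟨w, hw, hs, hp⟩ := hσ
    obtain ⟨w', hw', hs', hp'⟩ := hτ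
    refine ⟨w ++ w', ?_, ?_, by rw [List.prod_append, hp, hp']⟩
    · have h1 := σ.two_mul_card_cycleType_le_sum
      have h2 := τ.two_mul_card_cycleType_le_sum
      rw [List.length_append, hw, hw', hd.cycleType_mul, Multiset.sum_add, Multiset.card_add]
      omega
    · intro κ hκ
      exact (List.mem_append.mp hκ).elim (hs κ) (hs' κ)

theorem transpositionLength_le {n : ℕ} (π : Perm (Fin n)) :
    transpositionLength π ≤ π.cycleType.sum - π.cycleType.card :=
  Nat.sInf_le π.exists_isSwap_prod_eq

/-- The conjugacy class of `π` has at least `(n / e²) ^ t(π)` members. -/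
theorem pow_transpositionLength_le_card_isConj_mul_exp {n : ℕ} (hn : 8 ≤ n) (π : Perm (Fin n)) :
    (n : ℝ) ^ transpositionLength π ≤
      Nat.card {τ : Perm (Fin n) | IsConj π τ} * Real.exp 2 ^ transpositionLength π := by
  have h := π.pow_le_card_isConj_mul_exp (by omega)
  obtain ⟨k, hk⟩ := Nat.exists_eq_add_of_le (transpositionLength_le π)
  -- Since `n / e² ≥ 1`, lowering the exponent from `s - c` to `t` only weakens the bound, so `t ≤ s
  -- - c` is enough.
  have he : Real.exp 2 ≤ n := by
    have h1 := Real.exp_one_lt_d9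
    have h2 : Real.exp 2 = Real.exp 1 ^ 2 := by rw [← Real.exp_nat_mul]; norm_num
    have h3 : (8 : ℝ) ≤ n := by exact_mod_cast hn
    have h4 := Real.exp_pos 1
    rw [h2]
    nlinarith
  rw [hk, pow_add, pow_add, ← mul_assoc] at h
  have hpos : 0 < Real.exp 2 ^ k := by positivity
  refine le_of_mul_le_mul_right (le_trans ?_ h) hpos
  gcongr

end

theorem lemma9 (A : ℝ) (hA : √2 * Real.exp 2 < A) :
    ∃ N : ℕ, ∀ n : ℕ, N ≤ n →
      ∀ (V : Type*) [AddCommGroup V] [Module ℂ V] [FiniteDimensional ℂ V]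
        (ρ : Representation ℂ (Equiv.Perm (Fin n)) V),
        ρ.IsIrreducible → IsBig ρ →
        ∀ π : Equiv.Perm (Fin n),
          √(n : ℝ) * Real.log n < (transpositionLength π : ℝ) →
          ‖ρ.character π / (Module.finrank ℂ V : ℂ)‖ ≤
            A ^ transpositionLength π * (n : ℝ) ^ (-(transpositionLength π : ℝ) / 2) := by

  refine ⟨8, fun n hn V _ _ _ ρ hρ hbig π hπ => ?_⟩
  have hclass := pow_transpositionLength_le_card_isConj_mul_exp hn π
  have hchar := hρ.card_isConj_mul_sq_norm_character_le π
  rw [Nat.card_perm, Nat.card_fin] at hchar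
  unfold IsBig at hbig
  generalize transpositionLength π = t at *
  have hKpos : (0 : ℝ) < Nat.card {τ : Equiv.Perm (Fin n) | IsConj π τ} := by
    have : Nonempty {τ : Equiv.Perm (Fin n) | IsConj π τ} := ⟨⟨π, IsConj.refl π⟩⟩
    exact_mod_cast Nat.card_pos
  generalize (Nat.card {τ : Equiv.Perm (Fin n) | IsConj π τ} : ℝ) = K at *
  have hn0 : (0 : ℝ) < n := by exact_mod_cast (by omega : 0 < n)
  have hfac : (0 : ℝ) < n.factorial := by exact_mod_cast n.factorial_pos
  generalize hd : (Module.finrank ℂ V : ℝ) = d at *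
  have hd0 : 0 < d := lt_of_le_of_lt (by positivity) hbig
  have hdim : (n.factorial : ℝ) ≤ d ^ 2 * Real.exp 2 ^ t := by
    -- The lower bound on `t` lets `e^{-t}` replace the factor `e^{-√n log n}` of bigness.
    have h1 : Real.exp (-t) * √(n.factorial : ℝ) ≤ d :=
      le_trans (by gcongr) hbig.le
    have h2 : Real.exp (-t) ^ 2 * Real.exp 2 ^ t = 1 := by
      rw [← Real.exp_nat_mul, ← Real.exp_nat_mul, ← Real.exp_add, Real.exp_eq_one_iff]
      push_cast
      ring
    calc (n.factorial : ℝ) = (Real.exp (-t) * √(n.factorial : ℝ)) ^ 2 * Real.exp 2 ^ t := by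
          rw [mul_pow, Real.sq_sqrt hfac.le, mul_right_comm, h2, one_mul]
      _ ≤ _ := by gcongr
  -- Only `e² ≤ A` is used; the factor `√2` is slack.
  have hAe : Real.exp 2 ≤ A := by
    refine le_trans ?_ hA.le
    exact le_mul_of_one_le_left (Real.exp_pos 2).le (Real.one_le_sqrt.mpr one_le_two)
  have hA0 : 0 < A := (Real.exp_pos 2).trans_le hAe
  have hrpow : ((n : ℝ) ^ (-(t : ℝ) / 2)) ^ 2 = ((n : ℝ) ^ t)⁻¹ := by
    rw [← Real.rpow_natCast, ← Real.rpow_mul hn0.le, ← Real.rpow_natCast, ← Real.rpow_neg hn0.le]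
    congr 1
    push_cast
    ring
  rw [norm_div, Complex.norm_natCast, hd]
  refine le_of_sq_le_sq ?_ (by positivity)
  rw [mul_pow, hrpow, div_pow, ← div_eq_mul_inv, div_le_div_iff₀ (by positivity) (by positivity)]
  refine le_of_mul_le_mul_left ?_ hKpos
  calc K * (‖ρ.character π‖ ^ 2 * (n : ℝ) ^ t) = K * ‖ρ.character π‖ ^ 2 * (n : ℝ) ^ t := by ring
    _ ≤ d ^ 2 * Real.exp 2 ^ t * (K * Real.exp 2 ^ t) :=
        mul_le_mul (hchar.trans hdim) hclass (by positivity) (by positivity)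
    _ = K * ((Real.exp 2 ^ t) ^ 2 * d ^ 2) := by ring
    _ ≤ K * ((A ^ t) ^ 2 * d ^ 2) := by gcongr
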